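/- **Setting.** A *Turing machine* $M=(Q,\Gamma,\delta,q_0,q_{halt})$ has finitely many states, one tape with squares $0,1,2,\dots$, alphabet $\Gamma=\{0,1,\sqcup,\triangleright\}$ and a total function $\delta:Q\times\Gamma\to Q\times\Gamma\times\{L,S,R\}$. The left end marker $\triangleright$ is never overwritten nor written elsewhere. On $\triangleright$ the head moves right, in every state $q\neq q_{halt}$. Moreover $\delta(q_{halt},a)=(q_{halt},a,S)$ for all $a$, and $q_{halt}$ is the only state with these transitions. On input $s\in\{0,1\}^*$ the tape is $\triangleright s_0s_1\cdots s_l\sqcup\sqcup\cdots$ and the head starts on square $0$. $M(s)=v$ means that $M$ halts with its head on square $1$ and $v$ written there. $t_M(n)$ is the maximal number of steps of $M$ on inputs of length $n$. **The theory of a computation.** Let $t$ be a constant symbol added to the language of set theory; $t_{i,j}=t(i)(j)$ is the content $(a,q,v)$ of square $j$ at time $i$ (symbol, state, and $v=1$ iff the head is there). $\mathbf T_{\langle M,s\rangle}$ is the finite sequence of formulas consisting of $\mathbf{def}_M$ followed by $\mathbf{input}_s$. Here $\mathbf{def}_M$ says that $t$ is a function on $\omega$ whose values are functions $\omega\to\Gamma\times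 Q\times\{0,1\}$, that square $0$ always contains $\triangleright$, that at each time exactly one square is being read, that each transition $\delta(q,a)=(p,c,d)$ is obeyed (one formula for each $(q,a)$), and that the initial row is $(\sqcup,q_0,0)$ exactly from some position on. $\mathbf{input}_s$ consists of the formulas $\forall j\,(j>|s|\to t_{0,j}=(\sqcup,q_0,0))$, $t_{0,0}=(\triangleright,q_0,1)$ and $t_{0,p+1}=(s_p,q_0,0)$ for $0\le p<|s|$. **Normal proofs and adjoint checkers.** A proof $\pi=\langle\varphi_0,\dots,\varphi_n\rangle$ from a finite sequence $T$ of formulas is a sequence in which each $\varphi_i$ is a logical axiom, or an axiom of ZFC, or a member of $T$, or follows from two earlier formulas by modus ponens, or is $\forall x_k\varphi_j$ with $j<i$. A *normal proof* of $M(r)=v$ is a proof from $\mathbf T_{\langle M,r\rangle}$ of $\exists i\; t_{i,1}=(v,q_{halt},1)$. A check sequence of $\pi$ records for each $i$ one of these five justifications of $\varphi_i$ (with the indices $j,k$ used). The *adjoint checker* $\mathbf{CK}_\pi$ accepts $(U,\sigma)$ iff $\sigma$ has the same length as $\pi$ and the recorded justification is correct at each position $i$ of $\sigma$, with $U$ in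 place of $T$. **The verifier.** Let $M$ be a Turing machine and $C=\{\mathbf{CK}_{\pi_0},\dots,\mathbf{CK}_{\pi_n}\}$ a finite set of adjoint checkers, where $\pi_i$ is a normal proof of $M(r_i)=v_i$ and $M(r_i)=v_i$ holds. The *$C$-generated verifier* $\mathbf F_C$ is the Turing machine that, on input $s\in\{0,1\}^*$, computes $\mathbf{CK}_{\pi_i}(\mathbf T_{\langle M,s\rangle},\pi_i)$ for $i=0,1,\dots$, one justification at a time; it outputs $1$ as soon as one of them accepts, and $0$ if none does. Since the $\pi_i$ are fixed, the verdicts on all justifications other than membership in $\mathbf T_{\langle M,s\rangle}$ are built into the finite control. To test $\varphi\in\mathbf T_{\langle M,s\rangle}$ for a member $\varphi$ of $\pi_i$, the machine compares $\varphi$ successively with $\mathbf{def}_M$, with $t_{0,0}=(\triangleright,q_0,1)$ and, reading $s$ from the left, with the formulas $t_{0,p+1}=(s_p,q_0,0)$. If it meets the first blank, it compares $\varphi$ with the formula for $|s|$. It stops the search negatively when the squares $1,\dots,|r_i|+1$ have been read without success. **Claim.** $\mathbf F_C$ halts on every input $s$ with output $1$ if $\mathbf{CK}_{\pi_i}(\mathbf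 T_{\langle M,s\rangle},\pi_i)=1$ for some $i$, and with output $0$ otherwise. Its time complexity is bounded: there is a number $K$ (depending on $M$ and $C$ only) such that $t_{\mathbf F_C}(|s|)<K$ for all $s\in\{0,1\}^*$. -/

import Mathlib

namespace CKV

/-! ## Turing machines -/

/-- The tape alphabet `{0, 1, ⊔, ▷}`. -/
inductive Sym : Type
  | bit (b : Bool)
  | blank
  | leftEnd
  deriving DecidableEq

/-- Head movements: left, stay, right. -/
inductive Dir : Type
  | L
  | S
  | R
  deriving DecidableEq

/-- A deterministic one-tape Turing machine over `{0, 1, ⊔, ▷}` with finite state set `Q`.  The left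
end marker is never overwritten, never written elsewhere, and always sends the head to the right,
except in the halting state, in which the machine does nothing. -/
structure TM (Q : Type) where
  finite : Finite Q
  δ : Q → Sym → Q × Sym × Dir
  q₀ : Q
  qhalt : Q
  left_end : ∀ q, q ≠ qhalt → (δ q Sym.leftEnd).2 = (Sym.leftEnd, Dir.R)
  not_left_end : ∀ q a, a ≠ Sym.leftEnd → (δ q a).2.1 ≠ Sym.leftEnd
  halt : ∀ a, δ qhalt a = (qhalt, a, Dir.S)
  halt_unique : ∀ q, (∀ a, δ q a = δ qhalt a) → q = qhalt

/-- A configuration: current state, head position, tape content. -/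
structure Cfg (Q : Type) where
  state : Q
  head : ℕ
  tape : ℕ → Sym

/-- The new head position. (A machine never moves left from square `0`.) -/
def Dir.move : Dir → ℕ → ℕ
  | Dir.L, h => h - 1
  | Dir.S, h => h
  | Dir.R, h => h + 1

namespace TM

variable {Q : Type}

/-- One step of computation. -/
def step (M : TM Q) (c : Cfg Q) : Cfg Q :=
  let r := M.δ c.state (c.tape c.head)
  ⟨r.1, r.2.2.move c.head, Function.update c.tape c.head r.2.1⟩

/-- The initial tape `▷ s₀ s₁ … s_l ⊔ ⊔ …`. -/
def initTape (s : List Bool) : ℕ → Sym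
  | 0 => Sym.leftEnd
  | p + 1 => match s[p]? with
    | some b => Sym.bit b
    | none => Sym.blank

/-- The initial configuration: start state, head on square `0`. -/
def init (M : TM Q) (s : List Bool) : Cfg Q := ⟨M.q₀, 0, initTape s⟩

/-- The configuration after `n` steps on input `s`. -/
def run (M : TM Q) (s : List Bool) (n : ℕ) : Cfg Q := M.step^[n] (M.init s)

/-- `M` halts on input `s`. -/
def Halts (M : TM Q) (s : List Bool) : Prop := ∃ n, (M.run s n).state = M.qhalt

/-- `M(s) = v`: at some time `M` is in its halting state, with its head on square `1`, and that
square contains `v`. -/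
def Outputs (M : TM Q) (s : List Bool) (v : Bool) : Prop :=
  ∃ n, (M.run s n).state = M.qhalt ∧ (M.run s n).head = 1 ∧ (M.run s n).tape 1 = Sym.bit v

/-- The number of steps that `M` uses on input `s` (only meaningful if `M` halts on `s`). -/
noncomputable def steps (M : TM Q) (s : List Bool) : ℕ :=
  sInf {n | (M.run s n).state = M.qhalt}

/-- The time complexity `t_M(n)`: the maximum number of steps on inputs of length `n`
(only meaningful if `M` halts on all inputs). -/
noncomputable def timeComplexity (M : TM Q) (n : ℕ) : ℕ :=
  Finset.univ.sup fun s : Fin n → Bool => M.steps (List.ofFn s)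

end TM

/-! ## First-order formulas

The language has the binary relation `∈`, equality, and one constant symbol, which stands for the
computation table `t`. -/

/-- Terms: variables `x_k` and the constant symbol `t`. -/
inductive Tm : Type
  | var (k : ℕ)
  | tab
  deriving DecidableEq

/-- Formulas. -/
inductive Fm : Type
  | eq (u w : Tm)
  | mem (u w : Tm)
  | neg (α : Fm)
  | imp (α β : Fm)
  | all (k : ℕ) (α : Fm)
  deriving DecidableEq

namespace Fm

def or (α β : Fm) : Fm := imp (neg α) β
def and (α β : Fm) : Fm := neg (imp α (neg β))
def iff (α β : Fm) : Fm := and (imp α β) (imp β α)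
def ex (k : ℕ) (α : Fm) : Fm := neg (all k (neg α))

/-- Conjunction `α₁ ∧ (α₂ ∧ …)` of a nonempty list (some tautology for the empty list). -/
def conj : List Fm → Fm
  | [] => imp (eq Tm.tab Tm.tab) (eq Tm.tab Tm.tab)
  | [α] => α
  | α :: β :: l => and α (conj (β :: l))

/-- Disjunction of a nonempty list (some contradiction for the empty list). -/
def disj : List Fm → Fm
  | [] => neg (imp (eq Tm.tab Tm.tab) (eq Tm.tab Tm.tab))
  | [α] => α
  | α :: β :: l => or α (disj (β :: l))

/-- `x_k` occurs free in the formula. -/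
def FreeIn (k : ℕ) : Fm → Prop
  | eq u w => u = Tm.var k ∨ w = Tm.var k
  | mem u w => u = Tm.var k ∨ w = Tm.var k
  | neg α => FreeIn k α
  | imp α β => FreeIn k α ∨ FreeIn k β
  | all m α => m ≠ k ∧ FreeIn k α

/-- The formula has no free variable. -/
def IsSentence (α : Fm) : Prop := ∀ k, ¬ FreeIn k α

/-- The formula is in the language of set theory, i.e. does not contain the constant `t`. -/
def IsPure : Fm → Prop
  | eq u w => u ≠ Tm.tab ∧ w ≠ Tm.tab
  | mem u w => u ≠ Tm.tab ∧ w ≠ Tm.tab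
  | neg α => IsPure α
  | imp α β => IsPure α ∧ IsPure β
  | all _ α => IsPure α

/-- `∀ x_{k₁} ∀ x_{k₂} … α`. -/
def alls (l : List ℕ) (α : Fm) : Fm := l.foldr all α

end Fm

/-- Replace the variable `x_k` by the term `u` in a term. -/
def Tm.subst (k : ℕ) (u : Tm) (w : Tm) : Tm := if w = Tm.var k then u else w

namespace Fm

/-- `α_u^{x_k}`: replace the free occurrences of `x_k` by `u`. -/
def subst (k : ℕ) (u : Tm) : Fm → Fm
  | eq w z => eq (w.subst k u) (z.subst k u)
  | mem w z => mem (w.subst k u) (z.subst k u)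
  | neg α => neg (subst k u α)
  | imp α β => imp (subst k u α) (subst k u β)
  | all m α => if m = k then all m α else all m (subst k u α)

/-- The term `u` is substitutable for `x_k` in the formula. -/
def Substitutable (k : ℕ) (u : Tm) : Fm → Prop
  | eq _ _ => True
  | mem _ _ => True
  | neg α => Substitutable k u α
  | imp α β => Substitutable k u α ∧ Substitutable k u β
  | all m α => ¬ FreeIn k (all m α) ∨ (u ≠ Tm.var m ∧ Substitutable k u α)

/-- Propositional tautologies: true under every truth assignment to all formulas that respects
negation and implication. -/
def Tautology (α : Fm) : Prop :=
  ∀ v : Fm → Prop, (∀ β, v (neg β) ↔ ¬ v β) → (∀ β γ, v (imp β γ) ↔ (v β → v γ)) → v α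

/-- `β` is obtained from the atomic formula `α` by replacing one occurrence of `x_k` by `x_m`. -/
inductive ReplaceOne (k m : ℕ) : Fm → Fm → Prop
  | eq_left (w : Tm) : ReplaceOne k m (eq (Tm.var k) w) (eq (Tm.var m) w)
  | eq_right (w : Tm) : ReplaceOne k m (eq w (Tm.var k)) (eq w (Tm.var m))
  | mem_left (w : Tm) : ReplaceOne k m (mem (Tm.var k) w) (mem (Tm.var m) w)
  | mem_right (w : Tm) : ReplaceOne k m (mem w (Tm.var k)) (mem w (Tm.var m))

end Fm

open Fm

/-- The logical axioms `Λ`. -/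
inductive LogicAxiom : Fm → Prop
  | taut (α : Fm) : Tautology α → LogicAxiom α
  | inst (k : ℕ) (u : Tm) (α : Fm) : Substitutable k u α →
      LogicAxiom (imp (all k α) (subst k u α))
  | distrib (k : ℕ) (α β : Fm) :
      LogicAxiom (imp (all k (imp α β)) (imp (all k α) (all k β)))
  | vacuous (k : ℕ) (α : Fm) : ¬ FreeIn k α → LogicAxiom (imp α (all k α))
  | refl (k : ℕ) : LogicAxiom (eq (Tm.var k) (Tm.var k))
  | leibniz (k m : ℕ) (α β : Fm) : ReplaceOne k m α β →
      LogicAxiom (imp (eq (Tm.var k) (Tm.var m)) (imp α β))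
  | exIntro (k : ℕ) (u : Tm) (α : Fm) : Substitutable k u α →
      LogicAxiom (imp (subst k u α) (ex k α))

/-! ## Set-theoretic abbreviations

`x k` is the `k`-th variable.  In the abbreviations below, the argument `b` is the index of the first
variable that may be used as a bound variable; the variables among the other arguments are to have
indices below `b`. -/

/-- The variable `x_k`. -/
abbrev x (k : ℕ) : Tm := Tm.var k

/-- `∀ x_k ∈ y, α`. -/
def allMem (k : ℕ) (y : Tm) (α : Fm) : Fm := all k (imp (mem (x k) y) α)

/-- `∃ x_k ∈ y, α`. -/
def exMem (k : ℕ) (y : Tm) (α : Fm) : Fm := ex k (and (mem (x k) y) α)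

/-- `y = ∅`. -/
def isEmpty (b : ℕ) (y : Tm) : Fm := all b (neg (mem (x b) y))

/-- `y ⊆ z`. -/
def isSubset (b : ℕ) (y z : Tm) : Fm := allMem b y (mem (x b) z)

/-- `y = z ∪ {z}`. -/
def isSucc (b : ℕ) (y z : Tm) : Fm :=
  all b (iff (mem (x b) y) (or (mem (x b) z) (eq (x b) z)))

/-- `w = {y, z}`. -/
def isUPair (b : ℕ) (w y z : Tm) : Fm :=
  all b (iff (mem (x b) w) (or (eq (x b) y) (eq (x b) z)))

/-- `w = (y, z)`, the Kuratowski pair `{{y}, {y, z}}`. -/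
def isPair (b : ℕ) (w y z : Tm) : Fm :=
  all b (iff (mem (x b) w) (or (isUPair (b + 1) (x b) y y) (isUPair (b + 1) (x b) y z)))

/-- `w = (y, z, u) = ((y, z), u)`. -/
def isTriple (b : ℕ) (w y z u : Tm) : Fm :=
  ex b (and (isPair (b + 1) (x b) y z) (isPair (b + 1) w (x b) u))

/-- `(y, z) ∈ f`. -/
def pairMem (b : ℕ) (f y z : Tm) : Fm :=
  ex b (and (isPair (b + 1) (x b) y z) (mem (x b) f))

/-- `y` contains `∅` and is closed under successor. -/
def isInductive (b : ℕ) (y : Tm) : Fm :=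
  and (exMem b y (isEmpty (b + 1) (x b)))
    (allMem b y (exMem (b + 1) y (isSucc (b + 2) (x (b + 1)) (x b))))

/-- `y = ω`, the least inductive set. -/
def isOmega (b : ℕ) (y : Tm) : Fm :=
  and (isInductive b y) (all b (imp (isInductive (b + 1) (x b)) (isSubset (b + 1) y (x b))))

/-- `y ∈ ω`. -/
def inOmega (b : ℕ) (y : Tm) : Fm := ex b (and (isOmega (b + 1) (x b)) (mem y (x b)))

/-- `∀ x_k ∈ ω, α`. -/
def allNat (k : ℕ) (α : Fm) : Fm := all k (imp (inOmega (k + 1) (x k)) α)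

/-- `∃ x_k ∈ ω, α`. -/
def exNat (k : ℕ) (α : Fm) : Fm := ex k (and (inOmega (k + 1) (x k)) α)

/-- `y = n`, for the von Neumann numeral `n`. -/
def isNum : ℕ → ℕ → Tm → Fm
  | 0, b, y => isEmpty b y
  | n + 1, b, y => ex b (and (isNum n (b + 1) (x b)) (isSucc (b + 1) y (x b)))

/-- `α` with the numeral `n` for `x_k`, i.e. `∃ x_k (x_k = n ∧ α)`. -/
def letNum (k n : ℕ) (α : Fm) : Fm := ex k (and (isNum n (k + 1) (x k)) α)

/-- `f` is a function with domain `ω`. -/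
def isFunOnOmega (b : ℕ) (f : Tm) : Fm :=
  and (allMem b f (exNat (b + 1) (ex (b + 2) (isPair (b + 3) (x b) (x (b + 1)) (x (b + 2))))))
    (allNat b (ex (b + 1) (all (b + 2)
      (iff (pairMem (b + 3) f (x b) (x (b + 2))) (eq (x (b + 2)) (x (b + 1)))))))

/-! ## The axioms of ZFC -/

/-- The axioms of ZFC before universal closure; the schemes allow parameters. -/
inductive ZFCBody : Fm → Prop
  | extensionality : ZFCBody
      (imp (all 2 (iff (mem (x 2) (x 0)) (mem (x 2) (x 1)))) (eq (x 0) (x 1)))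
  | foundation : ZFCBody
      (imp (ex 1 (mem (x 1) (x 0)))
        (exMem 1 (x 0) (neg (ex 2 (and (mem (x 2) (x 0)) (mem (x 2) (x 1)))))))
  | pairing : ZFCBody (ex 2 (isUPair 3 (x 2) (x 0) (x 1)))
  | union : ZFCBody
      (ex 1 (all 2 (iff (mem (x 2) (x 1)) (exMem 3 (x 0) (mem (x 2) (x 3))))))
  | powerset : ZFCBody (ex 1 (all 2 (iff (mem (x 2) (x 1)) (isSubset 3 (x 2) (x 0)))))
  | infinity : ZFCBody (ex 0 (isInductive 1 (x 0)))
  /-- `∃ b ∀ y (y ∈ b ↔ y ∈ a ∧ α)`. -/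
  | separation (α : Fm) (a b y : ℕ) : IsPure α → [a, b, y].Nodup → ¬ FreeIn b α →
      ZFCBody (ex b (all y (iff (mem (x y) (x b)) (and (mem (x y) (x a)) α))))
  /-- `(∀ y ∈ a ∃! z α) → ∃ b ∀ y ∈ a ∃ z ∈ b α`. -/
  | replacement (α : Fm) (a b y z w : ℕ) : IsPure α → [a, b, y, z, w].Nodup →
      ¬ FreeIn b α → ¬ FreeIn w α →
      ZFCBody (imp (allMem y (x a) (ex w (all z (iff α (eq (x z) (x w))))))
        (ex b (allMem y (x a) (exMem z (x b) α))))
  /-- Every set of nonempty pairwise disjoint sets has a transversal. -/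
  | choice : ZFCBody
      (imp
        (and (allMem 1 (x 0) (ex 2 (mem (x 2) (x 1))))
          (allMem 1 (x 0) (allMem 2 (x 0)
            (imp (ex 3 (and (mem (x 3) (x 1)) (mem (x 3) (x 2)))) (eq (x 1) (x 2))))))
        (ex 1 (allMem 2 (x 0) (ex 3 (all 4
          (iff (and (mem (x 4) (x 2)) (mem (x 4) (x 1))) (eq (x 4) (x 3))))))))

/-- The axioms of ZFC: universal closures of the above. -/
def ZFC (α : Fm) : Prop := ∃ (l : List ℕ) (β : Fm), ZFCBody β ∧ α = alls l β ∧ IsSentence α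

/-! ## Proofs and adjoint checkers

A finite theory is given as a sequence (list) of formulas. -/

/-- The searching algorithm: compare `φ` with the members of the sequence one after the other. -/
def AL (φ : Fm) : List Fm → Bool
  | [] => false
  | ψ :: T => if φ = ψ then true else AL φ T

/-- `π` is a proof of `φ` from `T` in ZFC. -/
def IsProof (T : List Fm) (π : List Fm) (φ : Fm) : Prop :=
  π.getLast? = some φ ∧ ∀ (i : ℕ) (ψ : Fm), π[i]? = some ψ →
    LogicAxiom ψ ∨ ZFC ψ ∨ ψ ∈ T ∨
    (∃ j k : ℕ, j < i ∧ k < i ∧ ∃ χ, π[k]? = some χ ∧ π[j]? = some (imp χ ψ)) ∨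
    (∃ j k : ℕ, j < i ∧ ∃ χ, π[j]? = some χ ∧ ψ = all k χ)

/-- The five types of checkers. -/
inductive Checker : Type
  | logic
  | zfc
  | hyp
  | mp (j k : ℕ)
  | gen (j k : ℕ)

open Classical in
/-- The value of the checker `g` at position `i` of the formula sequence `σ`, for the theory `U`. -/
noncomputable def Checker.eval (U σ : List Fm) (i : ℕ) (g : Checker) : Bool :=
  match σ[i]? with
  | none => false
  | some φ =>
    match g with
    | logic => decide (LogicAxiom φ)
    | zfc => decide (ZFC φ)
    | hyp => AL φ U
    | mp j k => decide (j < i ∧ k < i ∧ ∃ χ, σ[k]? = some χ ∧ σ[j]? = some (imp χ φ))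
    | gen j k => decide (j < i ∧ ∃ χ, σ[j]? = some χ ∧ φ = all k χ)

/-- `G` is a proof type (adjoint check sequence) of the proof `π` from `T`. -/
def IsProofType (T π : List Fm) (G : List Checker) : Prop :=
  G.length = π.length ∧ ∀ (i : ℕ) (g : Checker), G[i]? = some g → g.eval T π i = true

/-- The algorithm described by a check sequence `G`, on input `(U, σ)`: compare the lengths, then
compute all the checkers. -/
noncomputable def CK (G : List Checker) (U σ : List Fm) : Bool :=
  decide (σ.length = G.length) && G.zipIdx.all fun p => p.1.eval U σ p.2

/-! ## The theory of a machine with a given input -/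

/-- The set-theoretic codes of the tape symbols. -/
def Sym.code : Sym → ℕ
  | Sym.bit false => 0
  | Sym.bit true => 1
  | Sym.blank => 2
  | Sym.leftEnd => 3

/-- All tape symbols. -/
def Sym.list : List Sym := [Sym.bit false, Sym.bit true, Sym.blank, Sym.leftEnd]

/-- `t(i)(j) = w`. -/
def tabVal (b : ℕ) (i j w : Tm) : Fm :=
  ex b (and (pairMem (b + 1) Tm.tab i (x b)) (pairMem (b + 1) (x b) j w))

section Theory

variable {Q : Type} [FinEnum Q]

/-- The set-theoretic code of a state: its number in the enumeration of `Q`. -/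
def stateCode (q : Q) : ℕ := (FinEnum.equiv q : Fin (FinEnum.card Q))

/-- `w = (y, q, v)`. -/
def isSquare (b : ℕ) (w y : Tm) (q : Q) (v : Bool) : Fm :=
  letNum b (stateCode q) (letNum (b + 1) v.toNat (isTriple (b + 2) w y (x b) (x (b + 1))))

/-- `t_{i,j} = (a, q, v)`. -/
def entry (b : ℕ) (i j : Tm) (a : Sym) (q : Q) (v : Bool) : Fm :=
  ex b (and (tabVal (b + 1) i j (x b))
    (letNum (b + 1) a.code (isSquare (b + 2) (x b) (x (b + 1)) q v)))

/-- `t_{i',j} = (π_M(t_{i,j}), p, v)`, where `π_M` is the projection to the tape symbol. -/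
def copied (b : ℕ) (i' i j : Tm) (p : Q) (v : Bool) : Fm :=
  ex b (ex (b + 1) (conj
    [tabVal (b + 2) i j (x b),
     ex (b + 2) (ex (b + 3) (isTriple (b + 4) (x b) (x (b + 1)) (x (b + 2)) (x (b + 3)))),
     ex (b + 2) (and (tabVal (b + 3) i' j (x (b + 2)))
       (isSquare (b + 3) (x (b + 2)) (x (b + 1)) p v))]))

variable (Q) in
/-- `t_{i,j} ∈ A × Q × V`, for explicitly given finite `A` and `V`. -/
def entryIn (b : ℕ) (i j : Tm) (A : List Sym) (V : List Bool) : Fm :=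
  disj (A.flatMap fun a => (FinEnum.toList Q).flatMap fun q => V.map fun v => entry b i j a q v)

variable (Q) in
/-- `t ∈ Table_M`: `t` is a function on `ω` whose values are functions `ω → Γ × Q × {0,1}`. -/
def isTable : Fm :=
  conj [isFunOnOmega 0 Tm.tab,
    allNat 0 (ex 1 (and (pairMem 2 Tm.tab (x 0) (x 1)) (isFunOnOmega 2 (x 1)))),
    allNat 0 (allNat 1 (entryIn Q 2 (x 0) (x 1) Sym.list [false, true]))]

variable (Q) in
/-- `∀ i, t_{i,0} ∈ {▷} × Q × {0,1}`. -/
def leftEndMarked : Fm :=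
  allNat 0 (letNum 1 0 (entryIn Q 2 (x 0) (x 1) [Sym.leftEnd] [false, true]))

variable (Q) in
/-- `∀ i ∃ k, t_{i,k} ∈ Γ × Q × {1} ∧ ∀ j (j ≠ k → t_{i,j} ∈ Γ × Q × {0})`. -/
def oneHead : Fm :=
  allNat 0 (exNat 1 (and (entryIn Q 2 (x 0) (x 1) Sym.list [true])
    (allNat 2 (imp (neg (eq (x 2) (x 1))) (entryIn Q 3 (x 0) (x 2) Sym.list [false])))))

/-- The formula for a transition `δ(q, a) = (p, c, d)`:
`∀ i ∀ j (t_{i,j} = (a, q, 1) → …)`, where `x₀ = i`, `x₁ = j`, `x₂ = i + 1`, and, if the head moves,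
`x₃ = j - 1` or `x₃ = j + 1` is its new position. -/
def transition (q : Q) (a : Sym) (p : Q) (c : Sym) (d : Dir) : Fm :=
  allNat 0 (allNat 1 (imp (entry 2 (x 0) (x 1) a q true) (ex 2 (and (isSucc 3 (x 2) (x 0))
    (match d with
      | Dir.S => and (entry 3 (x 2) (x 1) c p true)
          (allNat 3 (imp (neg (eq (x 3) (x 1))) (copied 4 (x 2) (x 0) (x 3) p false)))
      | Dir.L => ex 3 (and (isSucc 4 (x 1) (x 3)) (moved 4))
      | Dir.R => ex 3 (and (isSucc 4 (x 3) (x 1)) (moved 4)))))))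
where
  moved (b : ℕ) : Fm := conj
    [entry b (x 2) (x 1) c p false,
     copied b (x 2) (x 0) (x 3) p true,
     allNat b (imp (and (neg (eq (x b) (x 1))) (neg (eq (x b) (x 3))))
       (copied (b + 1) (x 2) (x 0) (x b) p false))]

variable (M : TM Q)

/-- `t_{0,j} = (⊔, q₀, 0)`. -/
def initBlank (b : ℕ) (j : Tm) : Fm :=
  letNum b 0 (entry (b + 1) (x b) j Sym.blank M.q₀ false)

/-- `∃ m ((∀ j < m, t_{0,j} ≠ (⊔, q₀, 0)) ∧ (∀ j ≥ m, t_{0,j} = (⊔, q₀, 0)))`. -/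
def inputEnds : Fm :=
  exNat 0 (and (allNat 1 (imp (mem (x 1) (x 0)) (neg (initBlank M 2 (x 1)))))
    (allNat 1 (imp (neg (mem (x 1) (x 0))) (initBlank M 2 (x 1)))))

/-- The formula sequence `def_M`. -/
def defM : List Fm :=
  [isTable Q, leftEndMarked Q, oneHead Q] ++
  ((FinEnum.toList Q).flatMap fun q => Sym.list.map fun a =>
    transition q a (M.δ q a).1 (M.δ q a).2.1 (M.δ q a).2.2) ++
  [inputEnds M]

/-- `∀ j (j > n → t_{0,j} = (⊔, q₀, 0))`, where `n` is the length of the input. -/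
def inputLength (n : ℕ) : Fm :=
  allNat 0 (imp (letNum 1 n (mem (x 1) (x 0))) (initBlank M 1 (x 0)))

/-- `t_{0,0} = (▷, q₀, 1)`. -/
def inputStart : Fm := letNum 0 0 (entry 1 (x 0) (x 0) Sym.leftEnd M.q₀ true)

/-- `t_{0,p+1} = (c, q₀, 0)`: the `p`-th bit of the input is `c`. -/
def inputBit (p : ℕ) (c : Bool) : Fm :=
  letNum 0 0 (letNum 1 (p + 1) (entry 2 (x 0) (x 1) (Sym.bit c) M.q₀ false))

/-- The formula sequence `input_s`. -/
def inputM (s : List Bool) : List Fm :=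
  inputLength M s.length :: inputStart M :: s.zipIdx.map fun c => inputBit M c.2 c.1

/-- The formula sequence `T_{⟨M,s⟩}`. -/
def theory (s : List Bool) : List Fm := defM M ++ inputM M s

/-- `∃ i, t_{i,1} = (v, q_halt, 1)`. -/
def outputIs (v : Bool) : Fm :=
  exNat 0 (letNum 1 1 (entry 2 (x 0) (x 1) (Sym.bit v) M.qhalt true))

/-- `π` is a normal proof of `M(s) = v`. -/
def IsNormalProof (s : List Bool) (v : Bool) (π : List Fm) : Prop :=
  IsProof (theory M s) π (outputIs M v)

/-- The data of an adjoint checker `CK_π` of a normal proof `π` of `M(r) = v`; `G` is the check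
sequence of the proof. (If a member of `π` can be justified in several ways, any choice is
admitted.) -/
structure AdjointChecker where
  r : List Bool
  v : Bool
  outputs : M.Outputs r v
  π : List Fm
  normal : IsNormalProof M r v π
  G : List Checker
  proofType : IsProofType (theory M r) π G

/-- The answer of the `C`-generated verifier on input `s`: is `CK_π(T_{⟨M,s⟩}, π) = 1` for some
member of `C`? -/
noncomputable def verifierValue (C : List (AdjointChecker M)) (s : List Bool) : Bool :=
  C.any fun c => CK c.G (theory M s) c.π

end Theory

/-! ## The verifier as a Turing machine -/

/-- Control flow of a verifier: answer `v`, or search for the formula `φ` in the theory of the input,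
inspecting only what concerns the first `B + 1` squares of the input, and branch. -/
inductive Prog : Type
  | ret (v : Bool)
  | search (φ : Fm) (B : ℕ) (yes no : Prog)

/-- States of the machine that answers: going back to the left end; writing the answer. -/
inductive RetState : Type
  | rewind
  | write

/-- States of the machine that searches: going back to the left end; reading the `p`-th bit. -/
inductive SearchState (B : ℕ) : Type
  | rewind
  | read (p : Fin (B + 1))

namespace Prog

/-- The states (other than the halting state) of the machine of a program. -/
def State : Prog → Type
  | ret _ => RetState
  | search _ B yes no => SearchState B ⊕ (yes.State ⊕ no.State)

/-- The first state of a program. -/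
def start : (P : Prog) → P.State
  | ret _ => RetState.rewind
  | search _ _ _ _ => Sum.inl SearchState.rewind

theorem finite_state : (P : Prog) → Finite P.State
  | ret _ => Finite.of_injective (β := Bool)
      (fun s : RetState => match s with
        | RetState.rewind => true
        | RetState.write => false) (by
        intro a b h; cases a <;> cases b <;> first | rfl | simp at h)
  | search φ B yes no => by
      have := finite_state yes
      have := finite_state no
      have : Finite (SearchState B) := Finite.of_injective (β := Option (Fin (B + 1)))
        (fun s => match s with
          | SearchState.rewind => none
          | SearchState.read p => some p) (by
          intro a b h; cases a <;> cases b <;> simp_all)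
      exact inferInstanceAs (Finite (SearchState B ⊕ (yes.State ⊕ no.State)))

/-- Transitions of the machine of a program (`none` is the halting state).  The formulas of the theory
of the input that do not depend on the input are in the finite control (`fixed`).  The other ones are
determined from the tape: if `c` is read on square `p + 1`, then `bit p c` is in the theory, and if
square `p + 1` is the first blank one, then `len p` is. -/
def next (fixed : List Fm) (len : ℕ → Fm) (bit : ℕ → Bool → Fm) :
    (P : Prog) → P.State → Sym → Option P.State × Sym × Dir
  | ret _, RetState.rewind, Sym.leftEnd => (some RetState.write, Sym.leftEnd, Dir.R)
  | ret _, RetState.rewind, a => (some RetState.rewind, a, Dir.L)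
  | ret _, RetState.write, Sym.leftEnd => (some RetState.write, Sym.leftEnd, Dir.R)
  | ret v, RetState.write, _ => (none, Sym.bit v, Dir.S)
  | search φ _ yes _, Sum.inl SearchState.rewind, Sym.leftEnd =>
      (some (if AL φ fixed then Sum.inr (Sum.inl yes.start) else Sum.inl (SearchState.read 0)),
        Sym.leftEnd, Dir.R)
  | search _ _ _ _, Sum.inl SearchState.rewind, a =>
      (some (Sum.inl SearchState.rewind), a, Dir.L)
  | search _ _ _ no, Sum.inl (SearchState.read _), Sym.leftEnd =>
      (some (Sum.inr (Sum.inr no.start)), Sym.leftEnd, Dir.R)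
  | search φ _ yes no, Sum.inl (SearchState.read p), Sym.blank =>
      (some (Sum.inr (if φ = len p then Sum.inl yes.start else Sum.inr no.start)),
        Sym.blank, Dir.S)
  | search φ B yes no, Sum.inl (SearchState.read p), Sym.bit c =>
      if φ = bit p c then (some (Sum.inr (Sum.inl yes.start)), Sym.bit c, Dir.S)
      else if h : p.val + 1 < B + 1 then
        (some (Sum.inl (SearchState.read ⟨p.val + 1, h⟩)), Sym.bit c, Dir.R)
      else (some (Sum.inr (Sum.inr no.start)), Sym.bit c, Dir.S)
  | search _ _ yes _, Sum.inr (Sum.inl q), a =>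
      let r := next fixed len bit yes q a
      (r.1.map fun q' => Sum.inr (Sum.inl q'), r.2)
  | search _ _ _ no, Sum.inr (Sum.inr q), a =>
      let r := next fixed len bit no q a
      (r.1.map fun q' => Sum.inr (Sum.inr q'), r.2)

theorem next_leftEnd (fixed : List Fm) (len : ℕ → Fm) (bit : ℕ → Bool → Fm) :
    (P : Prog) → (q : P.State) →
      (next fixed len bit P q Sym.leftEnd).2 = (Sym.leftEnd, Dir.R)
  | ret _, RetState.rewind => rfl
  | ret _, RetState.write => rfl
  | search _ _ _ _, Sum.inl SearchState.rewind => rfl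
  | search _ _ _ _, Sum.inl (SearchState.read _) => rfl
  | search _ _ yes _, Sum.inr (Sum.inl q) => next_leftEnd fixed len bit yes q
  | search _ _ _ no, Sum.inr (Sum.inr q) => next_leftEnd fixed len bit no q

theorem next_ne_leftEnd (fixed : List Fm) (len : ℕ → Fm) (bit : ℕ → Bool → Fm) :
    (P : Prog) → (q : P.State) → (a : Sym) → a ≠ Sym.leftEnd →
      (next fixed len bit P q a).2.1 ≠ Sym.leftEnd
  | ret _, RetState.rewind, a, h => by cases a <;> simp_all [next]
  | ret _, RetState.write, a, h => by cases a <;> simp_all [next]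
  | search _ _ _ _, Sum.inl SearchState.rewind, a, h => by cases a <;> simp_all [next]
  | search _ _ _ _, Sum.inl (SearchState.read _), a, h => by
      cases a
      · simp only [next]; split_ifs <;> simp
      · simp [next]
      · exact absurd rfl h
  | search _ _ yes _, Sum.inr (Sum.inl q), a, h => next_ne_leftEnd fixed len bit yes q a h
  | search _ _ _ no, Sum.inr (Sum.inr q), a, h => next_ne_leftEnd fixed len bit no q a h

/-- The Turing machine of a program. -/
def toTM (fixed : List Fm) (len : ℕ → Fm) (bit : ℕ → Bool → Fm) (P : Prog) :
    TM (Option P.State) where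
  finite := by
    have := P.finite_state
    infer_instance
  δ q a := match q with
    | none => (none, a, Dir.S)
    | some q => next fixed len bit P q a
  q₀ := some P.start
  qhalt := none
  left_end q h := by
    cases q with
    | none => exact absurd rfl h
    | some q => exact next_leftEnd fixed len bit P q
  not_left_end q a h := by
    cases q with
    | none => exact h
    | some q => exact next_ne_leftEnd fixed len bit P q a h
  halt _ := rfl
  halt_unique q h := by
    cases q with
    | none => rfl
    | some q =>
      have h1 := next_leftEnd fixed len bit P q
      have h2 : next fixed len bit P q Sym.leftEnd = (none, Sym.leftEnd, Dir.S) :=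
        h Sym.leftEnd
      rw [h2] at h1
      simp at h1

end Prog

section Verifier

variable {Q : Type} [FinEnum Q] {M : TM Q}

/-- Compute the checkers `gs` of `c` one after the other, each with its position in the sequence `π`;
go to `yes` if all of them return `1`, and to `no` as soon as one returns `0`.  A checker for
membership in the theory of the input is a search; since `π` is fixed and the searched formula is in
the theory of `c.r`, the search inspects at most the first `|r| + 1` squares of the input.  The other
checkers depend only on `π` and not on the input, so that their values are in the finite control. -/
noncomputable def checkAll (c : AdjointChecker M) : List (Checker × ℕ) → Prog → Prog → Prog
  | [], yes, _ => yes
  | (Checker.hyp, i) :: gs, yes, no =>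
      match c.π[i]? with
      | none => no
      | some φ => Prog.search φ c.r.length (checkAll c gs yes no) no
  | (g, i) :: gs, yes, no =>
      if g.eval [] c.π i then checkAll c gs yes no else no

/-- Run the adjoint checkers one after the other; answer `1` as soon as one of them accepts, and `0`
if none does. -/
noncomputable def verifierProg : List (AdjointChecker M) → Prog
  | [] => Prog.ret false
  | c :: C =>
      if c.π.length = c.G.length then
        checkAll c c.G.zipIdx (Prog.ret true) (verifierProg C)
      else verifierProg C

/-- The `C`-generated verifier `F_C`, a Turing machine. -/
noncomputable def generatedVerifier (M : TM Q) (C : List (AdjointChecker M)) :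
    TM (Option (verifierProg C).State) :=
  Prog.toTM (defM M ++ [inputStart M]) (inputLength M) (inputBit M) (verifierProg C)

end Verifier

end CKV

/-!
The formulas of `input_s` are tied to squares of the tape: `t_{0,p+1} = (c, q₀, 0)` can be found
only on square `p + 1`, and the formula for `|s|` only on square `|s| + 1`, and formulas tied to
different squares are different.  So a formula of `T_{⟨M,r⟩}`, which is either one of the formulas
common to all inputs or tied to one of the squares `1, …, |r| + 1`, can be looked up in
`T_{⟨M,s⟩}` by reading at most these squares of `s`.  Each search therefore takes boundedly many
steps and leaves the head within a bounded distance of the left end, to which the machine has to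
return before its next search.
-/

namespace CKV

open Fm

namespace Fm

theorem and_inj {α β γ δ : Fm} : and α β = and γ δ ↔ α = γ ∧ β = δ := by
  simp [and]

theorem ex_inj {k m : ℕ} {α β : Fm} : ex k α = ex m β ↔ k = m ∧ α = β := by
  simp [ex]

end Fm

theorem isNum_inj {n m b : ℕ} {y : Tm} : isNum n b y = isNum m b y ↔ n = m := by
  induction n generalizing m b y with
  | zero => cases m <;> simp [isNum, isEmpty, ex]
  | succ n ih =>
    cases m with
    | zero => simp [isNum, isEmpty, ex]
    | succ m => simp [isNum, ex_inj, and_inj, ih]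

theorem letNum_inj {k n m : ℕ} {α β : Fm} : letNum k n α = letNum k m β ↔ n = m ∧ α = β := by
  simp [letNum, ex_inj, and_inj, isNum_inj]

section InputFormulas

variable {Q : Type} [FinEnum Q] (M : TM Q)

theorem inputLength_injective : Function.Injective (inputLength M) := by
  intro n m h
  simpa [inputLength, allNat, letNum_inj] using h

theorem eq_of_inputBit_eq {p p' : ℕ} {c c' : Bool} (h : inputBit M p c = inputBit M p' c') :
    p = p' := by
  rw [inputBit, inputBit, letNum_inj, letNum_inj] at h
  exact Nat.succ.inj h.2.1

theorem inputLength_ne_inputBit (n p : ℕ) (c : Bool) : inputLength M n ≠ inputBit M p c := by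
  simp [inputLength, inputBit, allNat, letNum, ex]

end InputFormulas

theorem AL_eq_true_iff {φ : Fm} {T : List Fm} : AL φ T = true ↔ φ ∈ T := by
  induction T with
  | nil => simp [AL]
  | cons ψ T ih => by_cases h : φ = ψ <;> simp [AL, h, ih]

section ScannedFormulas

variable (len : ℕ → Fm) (bit : ℕ → Bool → Fm)

/-- The formulas that a search meets while reading the input `s` from the left up to the first
blank; the one at position `p` is determined by square `p + 1`. -/
def scannedFormulas (s : List Bool) : List Fm :=
  s.zipIdx.map (fun c => bit c.2 c.1) ++ [len s.length]

variable {s : List Bool} {p : ℕ}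

theorem length_scannedFormulas : (scannedFormulas len bit s).length = s.length + 1 := by
  simp [scannedFormulas]

theorem getElem_scannedFormulas (hp : p < (scannedFormulas len bit s).length) :
    (scannedFormulas len bit s)[p] = if h : p < s.length then bit p s[p] else len p := by
  have hps : p ≤ s.length := by rw [length_scannedFormulas] at hp; omega
  rcases hps.lt_or_eq with h | rfl
  · simp [scannedFormulas, h]
  · simp [scannedFormulas]

theorem drop_scannedFormulas (hp : p < s.length) :
    (scannedFormulas len bit s).drop p =
      bit p s[p] :: (scannedFormulas len bit s).drop (p + 1) := by
  rw [List.drop_eq_getElem_cons (by rw [length_scannedFormulas]; omega),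
    getElem_scannedFormulas, dif_pos hp]

theorem drop_length_scannedFormulas :
    (scannedFormulas len bit s).drop s.length = [len s.length] := by
  simp [scannedFormulas]

end ScannedFormulas

/-- The configuration with its state renamed along `f`. -/
def Cfg.map {Q Q' : Type} (f : Q → Q') (c : Cfg Q) : Cfg Q' := ⟨f c.state, c.head, c.tape⟩

namespace TM

variable {Q Q' : Type} {N : TM Q} {N' : TM Q'}

theorem initTape_succ_of_lt {s : List Bool} {p : ℕ} (hp : p < s.length) :
    initTape s (p + 1) = Sym.bit s[p] := by
  simp [initTape, hp]

theorem initTape_length_succ (s : List Bool) : initTape s (s.length + 1) = Sym.blank := by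
  simp [initTape]

theorem initTape_succ_ne_leftEnd (s : List Bool) (p : ℕ) :
    initTape s (p + 1) ≠ Sym.leftEnd := by
  rw [initTape]
  split <;> simp

theorem step_eq {q q' : Q} {h : ℕ} {t : ℕ → Sym} {a : Sym} {d : Dir}
    (hδ : N.δ q (t h) = (q', a, d)) :
    N.step ⟨q, h, t⟩ = ⟨q', d.move h, Function.update t h a⟩ := by
  simp [step, hδ]

theorem step_eq_of_unchanged {q q' : Q} {h : ℕ} {t : ℕ → Sym} {d : Dir}
    (hδ : N.δ q (t h) = (q', t h, d)) : N.step ⟨q, h, t⟩ = ⟨q', d.move h, t⟩ := by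
  rw [step_eq hδ, Function.update_eq_self]

/-- `N` gets from the configuration `c` to `c'` in at most `n` steps. -/
def ReachesWithin (N : TM Q) (n : ℕ) (c c' : Cfg Q) : Prop := ∃ m ≤ n, N.step^[m] c = c'

namespace ReachesWithin

variable {n n' : ℕ} {c c' c'' : Cfg Q}

theorem refl (c : Cfg Q) : N.ReachesWithin 0 c c := ⟨0, le_rfl, rfl⟩

theorem single (h : N.step c = c') : N.ReachesWithin 1 c c' := ⟨1, le_rfl, h⟩

theorem mono (h : N.ReachesWithin n c c') (hn : n ≤ n') : N.ReachesWithin n' c c' :=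
  let ⟨m, hm, e⟩ := h
  ⟨m, hm.trans hn, e⟩

theorem trans (h : N.ReachesWithin n c c') (h' : N.ReachesWithin n' c' c'') :
    N.ReachesWithin (n + n') c c'' := by
  obtain ⟨m, hm, rfl⟩ := h
  obtain ⟨m', hm', rfl⟩ := h'
  exact ⟨m' + m, by omega, Function.iterate_add_apply _ _ _ _⟩

theorem map {f : Q → Q'} (hf : ∀ q a, N'.δ (f q) a = Prod.map f id (N.δ q a))
    (h : N.ReachesWithin n c c') : N'.ReachesWithin n (c.map f) (c'.map f) := by
  obtain ⟨m, hm, rfl⟩ := h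
  have hstep : Function.Semiconj (Cfg.map f) N.step N'.step := fun c => by
    simp [Cfg.map, step, hf]
  exact ⟨m, hm, (hstep.iterate_right m c).symm⟩

end ReachesWithin

theorem reachesWithin_rewind {q : Q}
    (hq : ∀ a, a ≠ Sym.leftEnd → N.δ q a = (q, a, Dir.L)) (s : List Bool) (h : ℕ) :
    N.ReachesWithin h ⟨q, h, initTape s⟩ ⟨q, 0, initTape s⟩ := by
  induction h with
  | zero => exact .refl _
  | succ h ih =>
    have hleft : N.step ⟨q, h + 1, initTape s⟩ = ⟨q, h, initTape s⟩ :=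
      step_eq_of_unchanged (hq _ (initTape_succ_ne_leftEnd s h))
    exact ((ReachesWithin.single hleft).trans ih).mono (by omega)

/-- `N(s) = v`, and `N` halts on input `s` after at most `n` steps. -/
def OutputsWithin (N : TM Q) (n : ℕ) (s : List Bool) (v : Bool) : Prop :=
  ∃ m ≤ n, (N.run s m).state = N.qhalt ∧ (N.run s m).head = 1 ∧ (N.run s m).tape 1 = Sym.bit v

variable {n : ℕ} {s : List Bool} {v : Bool}

theorem ReachesWithin.outputsWithin {t : ℕ → Sym}
    (h : N.ReachesWithin n (N.init s) ⟨N.qhalt, 1, t⟩) (ht : t 1 = Sym.bit v) :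
    N.OutputsWithin n s v := by
  obtain ⟨m, hm, e⟩ := h
  refine ⟨m, hm, ?_⟩
  rw [run, e]
  exact ⟨rfl, rfl, ht⟩

theorem OutputsWithin.outputs (h : N.OutputsWithin n s v) : N.Outputs s v :=
  let ⟨m, _, hm⟩ := h
  ⟨m, hm⟩

theorem OutputsWithin.steps_le (h : N.OutputsWithin n s v) : N.steps s ≤ n :=
  let ⟨_, hmn, hm⟩ := h
  (Nat.sInf_le hm.1).trans hmn

theorem timeComplexity_le {K : ℕ} (h : ∀ s : List Bool, s.length = n → N.steps s ≤ K) :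
    N.timeComplexity n ≤ K :=
  Finset.sup_le fun _ _ => h _ List.length_ofFn

end TM

namespace Prog

open TM

variable (fixed : List Fm) (len : ℕ → Fm) (bit : ℕ → Bool → Fm)

/-- The formulas against which a search with bound `B` compares on input `s`: those in the finite
control, and those determined by the squares `1, …, B + 1`. -/
def visibleFormulas (B : ℕ) (s : List Bool) : List Fm :=
  fixed ++ (scannedFormulas len bit s).take (B + 1)

/-- The answer of a program on input `s`. -/
def value (s : List Bool) : Prog → Bool
  | ret v => v
  | search φ B yes no =>
      if φ ∈ visibleFormulas fixed len bit B s then value s yes else value s no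

/-- A bound for the number of steps of the machine of a program that is started on square `0`.  A
search with bound `B` reads at most the squares `0, …, B + 1` and ends on one of them; the next
rewinding accounts for the other `B + 1` steps. -/
def time : Prog → ℕ
  | ret _ => 2
  | search _ B yes no => 2 * B + 3 + max yes.time no.time

/-- The state of the machine of a search program in which it continues after the verdict `found`. -/
def afterSearch (φ : Fm) (B : ℕ) (yes no : Prog) (found : Bool) : (search φ B yes no).State :=
  Sum.inr (if found then Sum.inl yes.start else Sum.inr no.start)

section Search

variable (φ : Fm) (B : ℕ) (yes no : Prog) (s : List Bool)

theorem step_read_length (h : s.length < B + 1) :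
    (toTM fixed len bit (search φ B yes no)).step
        ⟨some (Sum.inl (SearchState.read ⟨s.length, h⟩)), s.length + 1, initTape s⟩ =
      ⟨some (afterSearch φ B yes no (φ = len s.length)), s.length + 1, initTape s⟩ :=
  step_eq_of_unchanged (d := Dir.S)
    (by simp [toTM, next, afterSearch, initTape_length_succ])

variable {φ B s} {p : ℕ}

theorem step_read_of_eq (hpB : p < B + 1) (hp : p < s.length) (hφ : φ = bit p s[p]) :
    (toTM fixed len bit (search φ B yes no)).step
        ⟨some (Sum.inl (SearchState.read ⟨p, hpB⟩)), p + 1, initTape s⟩ =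
      ⟨some (afterSearch φ B yes no true), p + 1, initTape s⟩ :=
  step_eq_of_unchanged (d := Dir.S)
    (by simp [toTM, next, afterSearch, initTape_succ_of_lt hp, ← hφ])

theorem step_read_of_ne (hpB : p + 1 < B + 1) (hp : p < s.length) (hφ : φ ≠ bit p s[p]) :
    (toTM fixed len bit (search φ B yes no)).step
        ⟨some (Sum.inl (SearchState.read ⟨p, by omega⟩)), p + 1, initTape s⟩ =
      ⟨some (Sum.inl (SearchState.read ⟨p + 1, hpB⟩)), p + 2, initTape s⟩ :=
  step_eq_of_unchanged (d := Dir.R)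
    (by simp [toTM, next, initTape_succ_of_lt hp, hφ, show p < B by omega])

theorem step_read_last_of_ne (hB : B < s.length) (hφ : φ ≠ bit B s[B]) :
    (toTM fixed len bit (search φ B yes no)).step
        ⟨some (Sum.inl (SearchState.read ⟨B, by omega⟩)), B + 1, initTape s⟩ =
      ⟨some (afterSearch φ B yes no false), B + 1, initTape s⟩ :=
  step_eq_of_unchanged (d := Dir.S)
    (by simp [toTM, next, afterSearch, initTape_succ_of_lt hB, hφ])

theorem exists_reachesWithin_read {k : ℕ} (hk : p + k = B) (hp : p ≤ s.length) :
    ∃ h ≤ B + 1, (toTM fixed len bit (search φ B yes no)).ReachesWithin (k + 1)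
      ⟨some (Sum.inl (SearchState.read ⟨p, by omega⟩)), p + 1, initTape s⟩
      ⟨some (afterSearch φ B yes no
        (φ ∈ ((scannedFormulas len bit s).drop p).take (k + 1))), h, initTape s⟩ := by
  induction k generalizing p with
  | zero =>
    obtain rfl : p = B := hk
    refine ⟨p + 1, le_rfl, .single ?_⟩
    rcases hp.lt_or_eq with hp | rfl
    · rw [drop_scannedFormulas len bit hp]
      by_cases hφ : φ = bit p s[p]
      · simpa [← hφ] using step_read_of_eq fixed len bit yes no _ hp hφ
      · simpa [hφ] using step_read_last_of_ne fixed len bit yes no hp hφ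
    · rw [drop_length_scannedFormulas]
      simpa using step_read_length fixed len bit φ _ yes no s _
  | succ k ih =>
    rcases hp.lt_or_eq with hp | rfl
    · rw [drop_scannedFormulas len bit hp]
      by_cases hφ : φ = bit p s[p]
      · refine ⟨p + 1, by omega, .mono (.single ?_) (by omega : 1 ≤ k + 1 + 1)⟩
        simpa [← hφ] using step_read_of_eq fixed len bit yes no (by omega) hp hφ
      · obtain ⟨h, hh, hread⟩ := ih (p := p + 1) (by omega) hp
        have hstep := step_read_of_ne fixed len bit yes no (by omega : p + 1 < B + 1) hp hφ
        refine ⟨h, hh, ?_⟩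
        simpa [hφ] using ((ReachesWithin.single hstep).trans hread).mono
          (by omega : 1 + (k + 1) ≤ k + 1 + 1)
    · refine ⟨s.length + 1, by omega, .mono (.single ?_) (by omega : 1 ≤ k + 1 + 1)⟩
      rw [drop_length_scannedFormulas]
      simpa using step_read_length fixed len bit φ B yes no s (by omega)

theorem step_start_of_mem (hφ : φ ∈ fixed) :
    (toTM fixed len bit (search φ B yes no)).step
        ⟨some (search φ B yes no).start, 0, initTape s⟩ =
      ⟨some (afterSearch φ B yes no true), 1, initTape s⟩ :=
  step_eq_of_unchanged (d := Dir.R)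
    (congrArg (fun q => (some q, Sym.leftEnd, Dir.R)) (if_pos (AL_eq_true_iff.2 hφ)))

theorem step_start_of_notMem (hφ : φ ∉ fixed) :
    (toTM fixed len bit (search φ B yes no)).step
        ⟨some (search φ B yes no).start, 0, initTape s⟩ =
      ⟨some (Sum.inl (SearchState.read 0)), 1, initTape s⟩ :=
  step_eq_of_unchanged (d := Dir.R)
    (congrArg (fun q => (some q, Sym.leftEnd, Dir.R)) (if_neg (mt AL_eq_true_iff.1 hφ)))

theorem exists_reachesWithin_search (h : ℕ) :
    ∃ h' ≤ B + 1, (toTM fixed len bit (search φ B yes no)).ReachesWithin (h + (B + 2))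
      ⟨some (search φ B yes no).start, h, initTape s⟩
      ⟨some (afterSearch φ B yes no (φ ∈ visibleFormulas fixed len bit B s)),
        h', initTape s⟩ := by
  have hrewind := reachesWithin_rewind (N := toTM fixed len bit (search φ B yes no))
    (q := some (search φ B yes no).start)
    (fun a ha => by cases a <;> first | rfl | exact absurd rfl ha) s h
  by_cases hφ : φ ∈ fixed
  · have hstart := step_start_of_mem fixed len bit yes no hφ (B := B) (s := s)
    refine ⟨1, by omega, ?_⟩
    simpa [hφ, visibleFormulas] using
      (hrewind.trans (.single hstart)).mono (by omega : _ ≤ h + (B + 2))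
  · have hstart := step_start_of_notMem fixed len bit yes no hφ (B := B) (s := s)
    obtain ⟨h', hh', hread⟩ :=
      exists_reachesWithin_read fixed len bit yes no (zero_add B) s.length.zero_le (φ := φ)
    refine ⟨h', hh', ?_⟩
    simpa [hφ, visibleFormulas] using
      ((hrewind.trans (.single hstart)).trans hread).mono (by omega : _ ≤ h + (B + 2))

end Search

variable (s : List Bool)

theorem reachesWithin_ret (v : Bool) (h : ℕ) :
    (toTM fixed len bit (ret v)).ReachesWithin (h + 2) ⟨some (ret v).start, h, initTape s⟩
      ⟨none, 1, Function.update (initTape s) 1 (Sym.bit v)⟩ := by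
  have hrewind := reachesWithin_rewind (N := toTM fixed len bit (ret v))
    (q := some (ret v).start)
    (fun a ha => by cases a <;> first | rfl | exact absurd rfl ha) s h
  have hright : (toTM fixed len bit (ret v)).step ⟨some (ret v).start, 0, initTape s⟩ =
      ⟨some RetState.write, 1, initTape s⟩ :=
    step_eq_of_unchanged (d := Dir.R) rfl
  have hδ : (toTM fixed len bit (ret v)).δ (some RetState.write) (initTape s 1) =
      (none, Sym.bit v, Dir.S) := by
    cases ha : initTape s 1
    case leftEnd => exact absurd ha (initTape_succ_ne_leftEnd s 0)
    all_goals rfl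
  have hwrite := step_eq hδ
  exact (hrewind.trans (.single hright)).trans (.single hwrite)

theorem reachesWithin_value (P : Prog) (h : ℕ) :
    (toTM fixed len bit P).ReachesWithin (h + P.time) ⟨some P.start, h, initTape s⟩
      ⟨none, 1, Function.update (initTape s) 1 (Sym.bit (P.value fixed len bit s))⟩ := by
  induction P generalizing h with
  | ret v => exact reachesWithin_ret fixed len bit s v h
  | search φ B yes no ihYes ihNo =>
    obtain ⟨h', hh', hsearch⟩ :=
      exists_reachesWithin_search fixed len bit yes no h (φ := φ) (B := B) (s := s)
    by_cases hφ : φ ∈ visibleFormulas fixed len bit B s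
    · have hyes := (ihYes h').map (N' := toTM fixed len bit (search φ B yes no))
        (f := Option.map fun q => Sum.inr (Sum.inl q)) (by rintro (_ | q) a <;> rfl)
      simp only [hφ, decide_true] at hsearch
      simp only [value, if_pos hφ]
      exact (hsearch.trans hyes).mono (by simp only [time]; omega)
    · have hno := (ihNo h').map (N' := toTM fixed len bit (search φ B yes no))
        (f := Option.map fun q => Sum.inr (Sum.inr q)) (by rintro (_ | q) a <;> rfl)
      simp only [hφ, decide_false] at hsearch
      simp only [value, if_neg hφ]
      exact (hsearch.trans hno).mono (by simp only [time]; omega)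

theorem outputsWithin_value (P : Prog) :
    (toTM fixed len bit P).OutputsWithin P.time s (P.value fixed len bit s) :=
  ((reachesWithin_value fixed len bit s P 0).mono (zero_add _).le).outputsWithin
    (Function.update_self ..)

end Prog

section Verifier

variable {Q : Type} [FinEnum Q] {M : TM Q} {r s : List Bool} {φ : Fm}

theorem mem_theory_iff : φ ∈ theory M s ↔
    φ ∈ defM M ++ [inputStart M] ∨ φ ∈ scannedFormulas (inputLength M) (inputBit M) s := by
  simp only [theory, inputM, scannedFormulas, List.mem_append, List.mem_cons, List.not_mem_nil,
    or_false]
  tauto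

theorem eq_of_getElem_scannedFormulas_eq {m n : ℕ}
    (hm : m < (scannedFormulas (inputLength M) (inputBit M) r).length)
    (hn : n < (scannedFormulas (inputLength M) (inputBit M) s).length)
    (h : (scannedFormulas (inputLength M) (inputBit M) r)[m] =
      (scannedFormulas (inputLength M) (inputBit M) s)[n]) : m = n := by
  simp only [getElem_scannedFormulas] at h
  split_ifs at h
  · exact eq_of_inputBit_eq M h
  · exact absurd h.symm (inputLength_ne_inputBit M _ _ _)
  · exact absurd h (inputLength_ne_inputBit M _ _ _)
  · exact inputLength_injective M h

theorem mem_theory_iff_mem_visibleFormulas (hr : φ ∈ theory M r) : φ ∈ theory M s ↔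
    φ ∈ Prog.visibleFormulas (defM M ++ [inputStart M]) (inputLength M) (inputBit M)
      r.length s := by
  rw [mem_theory_iff, Prog.visibleFormulas, List.mem_append (s := defM M ++ [inputStart M])]
  refine or_congr_right' fun hfixed => ⟨fun hs => ?_, List.mem_of_mem_take⟩
  obtain ⟨m, hm, hmφ⟩ := List.mem_iff_getElem.1 ((mem_theory_iff.1 hr).resolve_left hfixed)
  obtain ⟨n, hn, hnφ⟩ := List.mem_iff_getElem.1 hs
  obtain rfl := eq_of_getElem_scannedFormulas_eq hm hn (hmφ.trans hnφ.symm)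
  rw [length_scannedFormulas] at hm
  exact List.mem_take_iff_getElem.2 ⟨m, lt_min hm hn, hnφ⟩

variable (M) in
/-- The answer of a program on input `s`, its searches being in the theory of `M` with input `s`. -/
abbrev theoryValue (s : List Bool) (P : Prog) : Bool :=
  P.value (defM M ++ [inputStart M]) (inputLength M) (inputBit M) s

variable (c : AdjointChecker M) (s) (yes no : Prog)

theorem theoryValue_checkAll_cons {g : Checker} {i : ℕ} (gs : List (Checker × ℕ))
    (hg : g.eval (theory M c.r) c.π i = true) :
    theoryValue M s (checkAll c ((g, i) :: gs) yes no) =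
      if g.eval (theory M s) c.π i then theoryValue M s (checkAll c gs yes no)
      else theoryValue M s no := by
  cases g
  case hyp =>
    cases hφ : c.π[i]? with
    | none => simp [Checker.eval, hφ] at hg
    | some φ =>
      simp only [Checker.eval, hφ, AL_eq_true_iff] at hg
      simp only [checkAll, Checker.eval, hφ, theoryValue, Prog.value, AL_eq_true_iff,
        mem_theory_iff_mem_visibleFormulas (s := s) hg]
  all_goals exact apply_ite (theoryValue M s) _ _ _

theorem theoryValue_checkAll {gs : List (Checker × ℕ)}
    (hgs : ∀ p ∈ gs, p.1.eval (theory M c.r) c.π p.2 = true) :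
    theoryValue M s (checkAll c gs yes no) =
      if gs.all fun p => p.1.eval (theory M s) c.π p.2 then theoryValue M s yes
      else theoryValue M s no := by
  induction gs with
  | nil => simp [checkAll]
  | cons p gs ih =>
    rw [List.forall_mem_cons] at hgs
    rw [theoryValue_checkAll_cons s c yes no gs hgs.1, ih hgs.2, List.all_cons]
    simp only [Bool.and_eq_true, ite_and]

theorem theoryValue_verifierProg (C : List (AdjointChecker M)) :
    theoryValue M s (verifierProg C) = verifierValue M C s := by
  induction C with
  | nil => rfl
  | cons c C ih =>
    have hlength : c.π.length = c.G.length := c.proofType.1.symm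
    have hG : ∀ p ∈ c.G.zipIdx, p.1.eval (theory M c.r) c.π p.2 = true := fun p hp =>
      c.proofType.2 p.2 p.1 (List.mem_zipIdx_iff_getElem?.1 hp)
    rw [verifierProg, if_pos hlength, theoryValue_checkAll s c _ _ hG, ih]
    simp [verifierValue, CK, hlength, Prog.value]

theorem generatedVerifier_outputsWithin (C : List (AdjointChecker M)) :
    (generatedVerifier M C).OutputsWithin (verifierProg C).time s (verifierValue M C s) := by
  rw [← theoryValue_verifierProg]
  exact Prog.outputsWithin_value ..

end Verifier

end CKV

theorem mainTheorem6 {Q : Type} [FinEnum Q] (M : CKV.TM Q) (C : List (CKV.AdjointChecker M)) :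
    (∀ s : List Bool,
      (CKV.generatedVerifier M C).Outputs s (CKV.verifierValue M C s)) ∧
    ∃ K : ℕ, ∀ s : List Bool,
      (CKV.generatedVerifier M C).timeComplexity s.length < K := by
  have hverifier (s : List Bool) := CKV.generatedVerifier_outputsWithin s C
  refine ⟨fun s => (hverifier s).outputs, (CKV.verifierProg C).time + 1, fun s => ?_⟩
  exact Nat.lt_succ_of_le (CKV.TM.timeComplexity_le fun r _ => (hverifier r).steps_le)
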